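/- For a locally convex topology $\sigma$ on a complex vector space $E$, let $\sigma_b$ denote the finest locally convex topology on $E$ that agrees with $\sigma$ on every $\sigma$-bounded subset of $E$, and let $E_\sigma^*$ denote the space of $\sigma$-continuous linear functionals on $E$ with its strong dual topology, i.e. the topology of uniform convergence on $\sigma$-bounded sets. A pro-$C^*$-algebra is a complete Hausdorff topological $*$-algebra over $\mathbb{C}$ (not necessarily unital) whose topology is determined by its continuous $C^*$-seminorms. Let $A$ be a pro-$C^*$-algebra with topology $\tau$. Its multiplier algebra $M(A)$ is the algebra of pairs $(l,r)$ of continuous linear maps $A\to A$ with $l(ab)=l(a)b$, $r(ab)=a\,r(b)$ and $r(a)b=a\,l(b)$ for all $a,b\in A$. The map $a\mapsto (x\mapsto ax,\ x\mapsto xa)$ sends $A$ to $M(A)$. The strict topology $\beta$ on $M(A)$ is the topology of pointwise convergence of the maps $A\to A\oplus A$, $a\mapsto (l(a),r(a))$. **Theorem.** Let $A$ be a pro-$C^*$-algebra with topology $\tau$, and let $\beta$ be the strict topology on $M(A)$. 1. The identity on functionals, respectively restriction of functionals along $A\to M(A)$, gives well-defined linear maps $$M(A)_\beta^*\hookrightarrow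 M(A)_{\beta_b}^*\hookrightarrow A_{\tau_b}^*,\qquad M(A)_\beta^*\xrightarrow{\ \cong\ }A_\tau^*\hookrightarrow A_{\tau_b}^*,$$ which form a commutative diagram. All of them are injective and homeomorphisms onto their images for the strong dual topologies, and $M(A)_\beta^*\to A_\tau^*$ is bijective, hence an isomorphism of topological vector spaces. 2. If $\tau$ and $\tau_b$ have the same continuous linear functionals on $A$, then $A_\tau^*\to A_{\tau_b}^*$, $M(A)_\beta^*\to M(A)_{\beta_b}^*$ and $M(A)_{\beta_b}^*\to A_{\tau_b}^*$ are bijective, hence isomorphisms of topological vector spaces. -/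

import Mathlib

open Topology

/-! ### Locally convex topologies, localization, duals -/

/-- The vector space `E` with the topology `t` (a type synonym, so that several topologies on one
space can be used side by side). -/
def Retop (E : Type*) (_t : TopologicalSpace E) : Type _ := E

namespace Retop

instance (E : Type*) [AddCommGroup E] (t : TopologicalSpace E) : AddCommGroup (Retop E t) :=
  inferInstanceAs (AddCommGroup E)

instance (E : Type*) [AddCommGroup E] [Module ℂ E] (t : TopologicalSpace E) :
    Module ℂ (Retop E t) :=
  inferInstanceAs (Module ℂ E)

instance (E : Type*) (t : TopologicalSpace E) : TopologicalSpace (Retop E t) := t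

/-- The identity map of `E`, with target `E` topologized by `t`. -/
def of {E : Type*} [AddCommGroup E] [Module ℂ E] (t : TopologicalSpace E) :
    E ≃ₗ[ℂ] Retop E t :=
  LinearEquiv.refl ℂ E

end Retop

/-- `t` is a locally convex vector space topology on the complex vector space `E`. -/
structure IsLocallyConvexTopology {E : Type*} [AddCommGroup E] [Module ℂ E]
    (t : TopologicalSpace E) : Prop where
  addGroup : @IsTopologicalAddGroup E t _
  smul : @ContinuousSMul ℂ E _ _ t
  locallyConvex : @LocallyConvexSpace ℝ E _ _ _ _ t

/-- `B` is bounded for the topology `t`, i.e. absorbed by every `t`-neighbourhood of `0`. -/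
def IsBoundedFor {E : Type*} [AddCommGroup E] [Module ℂ E] (t : TopologicalSpace E)
    (B : Set E) : Prop :=
  @Bornology.IsVonNBounded ℂ E _ _ _ t B

/-- The locally convex topologies on `E` that agree with `σ` on every `σ`-bounded set, in the
sense that both induce the same subspace topology there. -/
def agreeingTopologies {E : Type*} [AddCommGroup E] [Module ℂ E] (σ : TopologicalSpace E) :
    Set (TopologicalSpace E) :=
  {t | IsLocallyConvexTopology t ∧ ∀ B : Set E, IsBoundedFor σ B →
    t.induced (Subtype.val : B → E) = σ.induced (Subtype.val : B → E)}

/-- The bounded localization `σ_b` of a locally convex topology `σ`: the finest locally convex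
topology agreeing with `σ` on `σ`-bounded sets. In Mathlib's order on topologies smaller means
finer; see `isLeast_localized`. -/
def localized {E : Type*} [AddCommGroup E] [Module ℂ E] (σ : TopologicalSpace E) :
    TopologicalSpace E :=
  sInf (agreeingTopologies σ)

/-- `localized σ` itself agrees with `σ` on bounded sets, so it is the finest such topology. -/
theorem isLeast_localized {E : Type*} [AddCommGroup E] [Module ℂ E] {σ : TopologicalSpace E}
    (hσ : IsLocallyConvexTopology σ) : IsLeast (agreeingTopologies σ) (localized σ) := by
  refine ⟨⟨⟨?_, ?_, ?_⟩, ?_⟩, fun t ht => sInf_le ht⟩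
  · exact topologicalAddGroup_sInf fun t ht => ht.1.addGroup
  · exact continuousSMul_sInf fun t ht => ht.1.smul
  · exact LocallyConvexSpace.sInf fun t ht => ht.1.locallyConvex
  · intro B hB
    refine le_antisymm (induced_mono (sInf_le ⟨hσ, fun _ _ => rfl⟩)) ?_
    rw [localized, sInf_eq_iInf', induced_iInf]
    exact le_iInf fun t => (t.2.2 B hB).ge

/-! ### Pro-C*-algebras -/

/-- A C*-seminorm on a complex *-algebra. -/
structure IsCStarSeminorm {A : Type*} [NonUnitalRing A] [StarRing A] [Module ℂ A]
    (p : Seminorm ℂ A) : Prop where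
  mul_le : ∀ a b : A, p (a * b) ≤ p a * p b
  star_mul_self : ∀ a : A, p (star a * a) = p a * p a

/-- A (not necessarily unital) pro-C*-algebra: a complete Hausdorff topological *-algebra over `ℂ`
whose topology is determined by its continuous C*-seminorms. -/
class ProCStarAlgebra (A : Type*) [NonUnitalRing A] [StarRing A] [Module ℂ A]
    [IsScalarTower ℂ A A] [SMulCommClass ℂ A A] [StarModule ℂ A] [UniformSpace A] : Prop
    extends IsUniformAddGroup A, ContinuousMul A, ContinuousStar A, ContinuousSMul ℂ A,
      T2Space A, CompleteSpace A where
  withSeminorms : WithSeminorms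
    (fun p : {p : Seminorm ℂ A // IsCStarSeminorm p ∧ Continuous p} => p.1)

/-- The given topology of a pro-C*-algebra. -/
abbrev proTopology (A : Type*) [UniformSpace A] : TopologicalSpace A :=
  UniformSpace.toTopologicalSpace

section Multipliers

variable (A : Type*) [NonUnitalRing A] [StarRing A] [Module ℂ A] [IsScalarTower ℂ A A]
  [SMulCommClass ℂ A A] [StarModule ℂ A] [UniformSpace A] [ProCStarAlgebra A]

/-- The multiplier algebra `M(A)`: pairs `(l, r)` of continuous linear maps `A → A` with
`l (a b) = l(a) b`, `r (a b) = a r(b)` and `r(a) b = a l(b)`. The product is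
`(l₁, r₁) (l₂, r₂) = (l₁ ∘ l₂, r₂ ∘ r₁)`, whence the opposite algebra in the second component. -/
def multiplierAlgebra : Subalgebra ℂ ((A →L[ℂ] A) × (A →L[ℂ] A)ᵐᵒᵖ) where
  carrier := {x | (∀ a b : A, x.1 (a * b) = x.1 a * b) ∧
    (∀ a b : A, x.2.unop (a * b) = a * x.2.unop b) ∧
    (∀ a b : A, x.2.unop a * b = a * x.1 b)}
  mul_mem' := by
    rintro x y ⟨hx1, hx2, hx3⟩ ⟨hy1, hy2, hy3⟩
    refine ⟨fun a b => ?_, fun a b => ?_, fun a b => ?_⟩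
    · simp [hx1, hy1]
    · simp [hx2, hy2]
    · simp [hx3, hy3]
  add_mem' := by
    rintro x y ⟨hx1, hx2, hx3⟩ ⟨hy1, hy2, hy3⟩
    refine ⟨fun a b => ?_, fun a b => ?_, fun a b => ?_⟩
    · simp [hx1, hy1, add_mul]
    · simp [hx2, hy2, mul_add]
    · simp [hx3, hy3, mul_add, add_mul]
  algebraMap_mem' := by
    intro c
    refine ⟨fun a b => ?_, fun a b => ?_, fun a b => ?_⟩ <;>
      simp [Algebra.algebraMap_eq_smul_one, smul_mul_assoc, mul_smul_comm]

/-- The strict topology `β` on `M(A)`: the topology of pointwise convergence of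
`a ↦ (l a, r a)`, as maps from `A` to `A × A`. -/
def strictTopology : TopologicalSpace (multiplierAlgebra A) :=
  TopologicalSpace.induced
    (fun (x : multiplierAlgebra A) (a : A) => ((x.1.1 a, x.1.2.unop a) : A × A)) inferInstance

/-- The canonical map `A → M(A)`, sending `a` to left and right multiplication by `a`. -/
def toMultiplier : A →ₗ[ℂ] multiplierAlgebra A where
  toFun a := ⟨(⟨LinearMap.mulLeft ℂ a, continuous_const.mul continuous_id⟩,
      MulOpposite.op ⟨LinearMap.mulRight ℂ a, continuous_id.mul continuous_const⟩),
    fun b c => (mul_assoc a b c).symm, fun b c => mul_assoc b c a, fun b c => mul_assoc b a c⟩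
  map_add' a b := by
    apply Subtype.ext
    refine Prod.ext ?_ (MulOpposite.unop_injective ?_)
    · ext c; exact add_mul a b c
    · ext c; exact mul_add c a b
  map_smul' z a := by
    apply Subtype.ext
    refine Prod.ext ?_ (MulOpposite.unop_injective ?_)
    · ext c; exact smul_mul_assoc z a c
    · ext c; exact mul_smul_comm z c a

end Multipliers

/-! Every embedding claim reduces to one criterion, `isEmbedding_precomp_of_forall_bounded`:
precomposition with `T : E → F` is an embedding of strong duals once each bounded `S` in `F` has a
bounded `R` in `E` with `f(S)` in the closure of `f(T(R))` for all continuous functionals `f`. For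
the identity from `σ_b` to `σ`, take `R = S`, because `σ` and `σ_b` have the same bounded sets.

For `A → M(A)`, take `R = {l(e)}` with `(l, r)` in `S` and `e` in the unit ball of the C*-algebra of
bounded elements (those whose continuous C*-seminorms have a common bound). This algebra is dense in
`A`, so its approximate unit also works for `A`, and `l(e)` tends to `(l, r)` strictly. The net is
bounded, so it converges for `β_b` as well. Banach–Steinhaus on the bounded elements shows that `R`
is bounded.

Surjectivity of `M(A)_β^* → A_τ^*` rests on a factorization of Cohen type,
`exists_functional_le_seminorm_mul`: a continuous functional on `A` is dominated by `a ↦ K p(a c)`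
for a single `c`. The majorant extends to the strictly continuous seminorm `(l, r) ↦ K p(l(c))`, and
Hahn–Banach extends the functional. The second part is then a diagram chase. -/

/-! ### Density of the bounded elements. -/

section Density

open Filter
open Finset.HasAntidiagonal (antidiagonal mem_antidiagonal)
open scoped Nat

/-- `powSucc a n` is `a ^ (n + 1)` in a ring without unit. -/
def powSucc {R : Type*} [Mul R] (a : R) : ℕ → R
  | 0 => a
  | n + 1 => a * powSucc a n

theorem powSucc_mul {R : Type*} [Semigroup R] (a : R) (i j : ℕ) :
    powSucc a i * powSucc a j = powSucc a (i + j + 1) := by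
  induction i with
  | zero => simp [powSucc]
  | succ i ih =>
    rw [powSucc, mul_assoc, ih, show i + 1 + j + 1 = (i + j + 1) + 1 by omega]
    rfl

theorem star_powSucc {R : Type*} [Semigroup R] [StarMul R] {a : R} (ha : star a = a)
    (n : ℕ) : star (powSucc a n) = powSucc a n := by
  induction n with
  | zero => exact ha
  | succ n ih => rw [powSucc, star_mul, ih, ha]; exact powSucc_mul a n 0

theorem Seminorm.map_sum_le {E ι : Type*} [AddCommGroup E] [Module ℂ E] (p : Seminorm ℂ E)
    (s : Finset ι) (f : ι → E) : p (∑ i ∈ s, f i) ≤ ∑ i ∈ s, p (f i) :=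
  Finset.le_sum_of_subadditive p (map_zero p).le (map_add_le_add p) s f

theorem Seminorm.le_tsum_of_hasSum {E : Type*} [AddCommGroup E] [Module ℂ E] [TopologicalSpace E]
    {p : Seminorm ℂ E} (hp : Continuous p) {f : ℕ → E} {a : E}
    (hf : HasSum f a) (hs : Summable fun n => p (f n)) : p a ≤ ∑' n, p (f n) := by
  refine le_of_tendsto ((hp.tendsto a).comp hf) (Eventually.of_forall fun s => ?_)
  exact (Seminorm.map_sum_le p _ _).trans (hs.sum_le_tsum s fun n _ => apply_nonneg p _)

/-- The degree `N + 2` coefficient of `exp(z) exp(-z) = 1` vanishes. Splitting off the two boundary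
terms leaves the coefficients of the product of the two series without constant term. -/
theorem expCoeff_antidiagonal (z : ℂ) (N : ℕ) :
    ∑ k ∈ antidiagonal N, (z ^ (k.1 + 1) / ((k.1 + 1)! : ℂ)) *
      ((-z) ^ (k.2 + 1) / ((k.2 + 1)! : ℂ)) =
    -(z ^ (N + 2) / ((N + 2)! : ℂ) + (-z) ^ (N + 2) / ((N + 2)! : ℂ)) := by
  have h : ∑ k ∈ antidiagonal (N + 2), (z ^ k.1 / (k.1 ! : ℂ)) *
      ((-z) ^ k.2 / (k.2 ! : ℂ)) = 0 := by
    have h1 := (Commute.all z (-z)).add_pow' (N + 2)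
    rw [add_neg_cancel, zero_pow (by omega)] at h1
    have h2 : ((N + 2)! : ℂ) * ∑ k ∈ antidiagonal (N + 2), (z ^ k.1 / (k.1 ! : ℂ)) *
      ((-z) ^ k.2 / (k.2 ! : ℂ)) = 0 := by
      rw [h1, Finset.mul_sum]
      refine Finset.sum_congr rfl fun k hk => ?_
      rw [← mem_antidiagonal.1 hk, Nat.choose_symm_add, Nat.add_choose, nsmul_eq_mul,
        Nat.cast_div (Nat.factorial_mul_factorial_dvd_factorial_add _ _)
          (by exact_mod_cast (Nat.mul_pos (Nat.factorial_pos _) (Nat.factorial_pos _)).ne')]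
      push_cast
      have := Nat.factorial_ne_zero k.1
      have := Nat.factorial_ne_zero k.2
      field_simp
    exact (mul_eq_zero.1 h2).resolve_left (by exact_mod_cast Nat.factorial_ne_zero _)
  rw [Finset.Nat.sum_antidiagonal_succ, Finset.Nat.sum_antidiagonal_succ'] at h
  simp only [pow_zero, Nat.factorial_zero, Nat.cast_one, div_one, one_mul, mul_one] at h
  linear_combination h

variable {A : Type*} [NonUnitalRing A] [StarRing A] [Module ℂ A]

theorem IsCStarSeminorm.map_star {p : Seminorm ℂ A} (hp : IsCStarSeminorm p) (a : A) :
    p (star a) = p a := by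
  have key : ∀ b : A, p b ≤ p (star b) := by
    intro b
    have h1 := hp.star_mul_self b
    have h2 := hp.mul_le (star b) b
    rcases (apply_nonneg p b).eq_or_lt with h | h
    · rw [← h]; exact apply_nonneg p _
    · exact le_of_mul_le_mul_right (h1 ▸ h2) h
  exact le_antisymm (by simpa using key (star a)) (key a)

theorem IsCStarSeminorm.mul_star_self {p : Seminorm ℂ A} (hp : IsCStarSeminorm p) (a : A) :
    p (a * star a) = p a * p a := by
  simpa [hp.map_star] using hp.star_mul_self (star a)

/-- The continuous C*-seminorms of a topological *-algebra. -/
abbrev ContinuousCStarSeminorm (A : Type*) [NonUnitalRing A] [StarRing A] [Module ℂ A]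
    [TopologicalSpace A] : Type _ :=
  {p : Seminorm ℂ A // IsCStarSeminorm p ∧ Continuous p}

theorem IsCStarSeminorm.powSucc_le {p : Seminorm ℂ A} (hp : IsCStarSeminorm p) (a : A) (n : ℕ) :
    p (powSucc a n) ≤ p a ^ (n + 1) := by
  induction n with
  | zero => simp [powSucc]
  | succ n ih =>
    rw [powSucc, pow_succ']
    exact (hp.mul_le _ _).trans (by gcongr)

/-- The `n`-th term of the series of `exp (z a) - 1`. -/
noncomputable def expTerm (z : ℂ) (a : A) (n : ℕ) : A :=
  (z ^ (n + 1) / ((n + 1)! : ℂ)) • powSucc a n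

theorem IsCStarSeminorm.expTerm_le {p : Seminorm ℂ A} (hp : IsCStarSeminorm p) (z : ℂ) (a : A)
    (n : ℕ) : p (expTerm z a n) ≤ (‖z‖ * p a) ^ (n + 1) / (n + 1)! := by
  rw [expTerm, map_smul_eq_mul, norm_div, norm_pow, Complex.norm_natCast, mul_pow,
    div_mul_eq_mul_div]
  gcongr
  exact hp.powSucc_le a n

theorem summable_expBound (r : ℝ) : Summable fun n : ℕ => r ^ (n + 1) / ((n + 1)! : ℝ) :=
  (summable_nat_add_iff 1).2 (Real.summable_pow_div_factorial r)

theorem IsCStarSeminorm.summable_map_expTerm {p : Seminorm ℂ A} (hp : IsCStarSeminorm p) (z : ℂ)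
    (a : A) : Summable fun n => p (expTerm z a n) :=
  Summable.of_nonneg_of_le (fun _ => apply_nonneg p _) (hp.expTerm_le z a) (summable_expBound _)

variable [IsScalarTower ℂ A A] [SMulCommClass ℂ A A] [StarModule ℂ A] [UniformSpace A]
  [ProCStarAlgebra A]

theorem ProCStarAlgebra.tendsto_nhds {ι : Type*} {l : Filter ι} {u : ι → A} {a : A} :
    Tendsto u l (𝓝 a) ↔
      ∀ p : ContinuousCStarSeminorm A, Tendsto (fun i => p.1 (u i - a)) l (𝓝 0) := by
  rw [(ProCStarAlgebra.withSeminorms (A := A)).tendsto_nhds]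
  refine forall_congr' fun p => ?_
  rw [Metric.tendsto_nhds]
  simp [abs_of_nonneg]

theorem ProCStarAlgebra.eq_zero {a : A} (h : ∀ p : ContinuousCStarSeminorm A, p.1 a = 0) :
    a = 0 := by
  have : Tendsto (fun _ : ℕ => a) atTop (𝓝 0) := by
    rw [ProCStarAlgebra.tendsto_nhds]
    intro p
    simp [h p]
  exact tendsto_nhds_unique tendsto_const_nhds this

theorem ProCStarAlgebra.summable {ι : Type*} {f : ι → A}
    (h : ∀ p : ContinuousCStarSeminorm A, Summable fun i => p.1 (f i)) : Summable f := by
  classical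
  rw [summable_iff_vanishing]
  intro U hU
  obtain ⟨s, r, hr, hs⟩ := ((ProCStarAlgebra.withSeminorms (A := A)).mem_nhds_iff 0 U).1 hU
  have h1 : ∀ p : ContinuousCStarSeminorm A, ∃ F : Finset ι, ∀ t : Finset ι, Disjoint t F →
      ∑ i ∈ t, p.1 (f i) < r := by
    intro p
    obtain ⟨F, hF⟩ := summable_iff_vanishing.1 (h p) (Metric.ball 0 r) (Metric.ball_mem_nhds 0 hr)
    refine ⟨F, fun t ht => ?_⟩
    have := hF t ht
    rw [mem_ball_zero_iff, Real.norm_eq_abs] at this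
    exact (abs_lt.1 this).2
  choose F hF using h1
  refine ⟨s.biUnion F, fun t ht => hs ?_⟩
  rw [Seminorm.mem_ball, sub_zero]
  refine Seminorm.finset_sup_apply_lt hr fun p hp => ?_
  refine lt_of_le_of_lt (Seminorm.map_sum_le p.1 _ _) (hF p t ?_)
  exact ht.mono_right (Finset.subset_biUnion_of_mem F hp)

theorem summable_expTerm (z : ℂ) (a : A) : Summable (expTerm z a) :=
  ProCStarAlgebra.summable fun p => p.2.1.summable_map_expTerm z a

/-- `exp (z a) - 1`, as the sum of its power series. -/
noncomputable def expSubOne (z : ℂ) (a : A) : A := ∑' n, expTerm z a n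

/-- Formally `(u - 1)(u⁻¹ - 1) = -((u - 1) + (u⁻¹ - 1))` with `u = exp(za)`. Without a unit in `A`,
this is proved by comparing coefficients in the Cauchy product. -/
theorem expSubOne_mul_neg (z : ℂ) (a : A) :
    expSubOne z a * expSubOne (-z) a = -(expSubOne z a + expSubOne (-z) a) := by
  have hz := summable_expTerm z a
  have hw := summable_expTerm (-z) a
  have hzw : Summable fun x : ℕ × ℕ => expTerm z a x.1 * expTerm (-z) a x.2 := by
    refine ProCStarAlgebra.summable fun p => ?_
    have h := (p.2.1.summable_map_expTerm z a).mul_of_nonneg (p.2.1.summable_map_expTerm (-z) a)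
      (fun _ => apply_nonneg _ _) (fun _ => apply_nonneg _ _)
    exact Summable.of_nonneg_of_le (fun _ => apply_nonneg _ _) (fun x => p.2.1.mul_le _ _) h
  have : IsTopologicalSemiring A := {}
  rw [expSubOne, expSubOne, hz.tsum_mul_tsum_eq_tsum_sum_antidiagonal hw hzw,
    hz.tsum_eq_zero_add, hw.tsum_eq_zero_add]
  -- The product starts in degree two, so the linear terms of the sum have to cancel.
  have h0 : expTerm z a 0 + expTerm (-z) a 0 = 0 := by simp [expTerm]
  rw [add_add_add_comm, h0, zero_add,
    ← ((summable_nat_add_iff 1).2 hz).tsum_add ((summable_nat_add_iff 1).2 hw), ← tsum_neg]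
  refine tsum_congr fun N => ?_
  have h1 : ∀ k ∈ antidiagonal N, expTerm z a k.1 * expTerm (-z) a k.2 =
      ((z ^ (k.1 + 1) / ((k.1 + 1)! : ℂ)) * ((-z) ^ (k.2 + 1) / ((k.2 + 1)! : ℂ))) •
        powSucc a (N + 1) := by
    intro k hk
    rw [expTerm, expTerm, smul_mul_smul_comm, powSucc_mul, mem_antidiagonal.1 hk]
  rw [Finset.sum_congr rfl h1, ← Finset.sum_smul, expCoeff_antidiagonal, neg_smul, add_smul]
  rfl

theorem star_expSubOne {a : A} (ha : star a = a) {z : ℂ} (hz : star z = -z) :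
    star (expSubOne z a) = expSubOne (-z) a := by
  rw [expSubOne, tsum_star]
  refine tsum_congr fun n => ?_
  rw [expTerm, star_smul, star_powSucc ha, expTerm]
  simp [← hz]

/-- For `v = exp(za) - 1` with `za` skew-adjoint, `v v* = -(v + v*)`. Hence `p(v)² ≤ 2 p(v)`, a
bound that depends on neither `p` nor `a`. -/
theorem IsCStarSeminorm.expSubOne_le {p : Seminorm ℂ A} (hp : IsCStarSeminorm p) {a : A}
    (ha : star a = a) {z : ℂ} (hz : star z = -z) : p (expSubOne z a) ≤ 2 := by
  have h1 := hp.mul_star_self (expSubOne z a)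
  rw [star_expSubOne ha hz, expSubOne_mul_neg, map_neg_eq_map, ← star_expSubOne ha hz] at h1
  have h2 := map_add_le_add p (expSubOne z a) (star (expSubOne z a))
  rw [hp.map_star, h1] at h2
  have h3 := apply_nonneg p (expSubOne z a)
  by_contra! h
  nlinarith

theorem IsCStarSeminorm.expSubOne_sub_le {p : Seminorm ℂ A} (hp : IsCStarSeminorm p)
    (hc : Continuous p) (a : A) {z : ℂ} (hz : ‖z‖ ≤ 1) :
    p (expSubOne z a - z • a) ≤ ‖z‖ ^ 2 * ∑' n : ℕ, p a ^ (n + 2) / ((n + 2)! : ℝ) := by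
  have h := (summable_expTerm z a).hasSum
  have h1 : HasSum (fun n => expTerm z a (n + 1)) (expSubOne z a - z • a) := by
    have := (hasSum_nat_add_iff' 1).2 h
    simpa [expTerm, powSucc, expSubOne] using this
  have hs : Summable fun n : ℕ => p a ^ (n + 2) / ((n + 2)! : ℝ) :=
    (summable_nat_add_iff 2).2 (Real.summable_pow_div_factorial _)
  have h2 := (summable_nat_add_iff 1).2 (hp.summable_map_expTerm z a)
  refine (Seminorm.le_tsum_of_hasSum hc h1 h2).trans ?_
  rw [← tsum_mul_left]
  refine h2.tsum_le_tsum (fun n => (hp.expTerm_le z a (n + 1)).trans ?_) (hs.mul_left _)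
  rw [mul_pow, mul_div_assoc]
  gcongr ?_ * _
  exact pow_le_pow_of_le_one (norm_nonneg z) hz (by omega)

variable (A) in
/-- The *-subalgebra of the elements on which the continuous C*-seminorms are uniformly bounded. -/
def boundedSubalgebra : NonUnitalStarSubalgebra ℂ A where
  carrier := {a | ∃ C : ℝ, ∀ p : ContinuousCStarSeminorm A, p.1 a ≤ C}
  add_mem' := by
    rintro a b ⟨C, hC⟩ ⟨D, hD⟩
    exact ⟨C + D, fun p => (map_add_le_add p.1 a b).trans (add_le_add (hC p) (hD p))⟩
  zero_mem' := ⟨0, fun p => by simp⟩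
  mul_mem' := by
    rintro a b ⟨C, hC⟩ ⟨D, hD⟩
    exact ⟨C * D, fun p => (p.2.1.mul_le a b).trans
      (mul_le_mul (hC p) (hD p) (apply_nonneg _ _) ((apply_nonneg p.1 a).trans (hC p)))⟩
  smul_mem' := by
    rintro c a ⟨C, hC⟩
    refine ⟨‖c‖ * C, fun p => ?_⟩
    rw [map_smul_eq_mul]
    exact mul_le_mul_of_nonneg_left (hC p) (norm_nonneg c)
  star_mem' := by
    rintro a ⟨C, hC⟩
    exact ⟨C, fun p => (p.2.1.map_star a).trans_le (hC p)⟩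

theorem mem_closure_boundedSubalgebra_of_selfAdjoint {a : A} (ha : star a = a) :
    a ∈ closure (boundedSubalgebra A : Set A) := by
  -- With `z` imaginary and tending to `0`, the quotients `(exp(za) - 1)/z` are bounded elements and
  -- converge to the derivative `a`.
  let z : ℕ → ℂ := fun n => Complex.I * ((1 / ((n : ℝ) + 1) : ℝ) : ℂ)
  have hz : ∀ n, ‖z n‖ = 1 / ((n : ℝ) + 1) := fun n => by
    rw [norm_mul, Complex.norm_I, one_mul, Complex.norm_real, Real.norm_eq_abs,
      abs_of_nonneg (by positivity)]
  have hz1 : ∀ n, ‖z n‖ ≤ 1 := fun n => by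
    rw [hz]; exact div_le_one_of_le₀ (by linarith [n.cast_nonneg (α := ℝ)]) (by positivity)
  have hz0 : ∀ n, z n ≠ 0 := fun n => by
    rw [← norm_pos_iff, hz]; positivity
  have hzs : ∀ n, star (z n) = -z n := fun n => by
    simp only [z, star_mul', Complex.star_def, Complex.conj_I, Complex.conj_ofReal, neg_mul]
  have hmem : ∀ n, (z n)⁻¹ • expSubOne (z n) a ∈ boundedSubalgebra A := fun n =>
    SMulMemClass.smul_mem (z n)⁻¹ (show expSubOne (z n) a ∈ boundedSubalgebra A from
      ⟨2, fun p => p.2.1.expSubOne_le ha (hzs n)⟩)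
  refine mem_closure_of_tendsto (f := fun n => (z n)⁻¹ • expSubOne (z n) a) (b := atTop) ?_
    (Eventually.of_forall hmem)
  rw [ProCStarAlgebra.tendsto_nhds]
  intro p
  have hlim : Tendsto (fun n : ℕ => 1 / ((n : ℝ) + 1) *
      ∑' n : ℕ, p.1 a ^ (n + 2) / ((n + 2)! : ℝ)) atTop (𝓝 0) := by
    simpa using tendsto_one_div_add_atTop_nhds_zero_nat.mul_const
      (∑' n : ℕ, p.1 a ^ (n + 2) / ((n + 2)! : ℝ))
  refine squeeze_zero (fun n => apply_nonneg _ _) (fun n => ?_) hlim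
  have h1 : (z n)⁻¹ • expSubOne (z n) a - a = (z n)⁻¹ • (expSubOne (z n) a - z n • a) := by
    rw [smul_sub, smul_smul, inv_mul_cancel₀ (hz0 n), one_smul]
  rw [h1, map_smul_eq_mul, norm_inv]
  have h2 := p.2.1.expSubOne_sub_le p.2.2 a (hz1 n)
  have h3 : 0 < ‖z n‖ := norm_pos_iff.2 (hz0 n)
  rw [← hz, inv_mul_le_iff₀ h3, ← mul_assoc, ← sq]
  exact h2

theorem dense_boundedSubalgebra : Dense (boundedSubalgebra A : Set A) := by
  intro a
  let S : Submodule ℂ A := (boundedSubalgebra A).toNonUnitalSubalgebra.toSubmodule.topologicalClosure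
  have h1 : ((realPart a : A)) ∈ S :=
    mem_closure_boundedSubalgebra_of_selfAdjoint (realPart a).2
  have h2 : ((imaginaryPart a : A)) ∈ S :=
    mem_closure_boundedSubalgebra_of_selfAdjoint (imaginaryPart a).2
  have h3 : a ∈ S := by
    rw [← realPart_add_I_smul_imaginaryPart a]
    exact S.add_mem h1 (S.smul_mem _ h2)
  exact h3

end Density

/-! ### The C*-algebra of bounded elements and its approximate unit. -/

section BoundedElements

set_option linter.unusedSectionVars false

open Filter

variable (A : Type*) [NonUnitalRing A] [StarRing A] [Module ℂ A] [IsScalarTower ℂ A A]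
  [SMulCommClass ℂ A A] [StarModule ℂ A] [UniformSpace A] [ProCStarAlgebra A]

/-- The bounded elements of a pro-C*-algebra; a C*-algebra for the supremum of the continuous
C*-seminorms. -/
def BoundedElements : Type _ := ↥(boundedSubalgebra A)

namespace BoundedElements

noncomputable instance : NonUnitalRing (BoundedElements A) :=
  inferInstanceAs (NonUnitalRing ↥(boundedSubalgebra A))

noncomputable instance : StarRing (BoundedElements A) :=
  inferInstanceAs (StarRing ↥(boundedSubalgebra A))

noncomputable instance : Module ℂ (BoundedElements A) :=
  inferInstanceAs (Module ℂ ↥(boundedSubalgebra A))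

instance : IsScalarTower ℂ (BoundedElements A) (BoundedElements A) :=
  inferInstanceAs (IsScalarTower ℂ ↥(boundedSubalgebra A) ↥(boundedSubalgebra A))

instance : SMulCommClass ℂ (BoundedElements A) (BoundedElements A) :=
  inferInstanceAs (SMulCommClass ℂ ↥(boundedSubalgebra A) ↥(boundedSubalgebra A))

instance : StarModule ℂ (BoundedElements A) :=
  inferInstanceAs (StarModule ℂ ↥(boundedSubalgebra A))

/-- The inclusion of the bounded elements. -/
noncomputable def inclₗ : BoundedElements A →ₗ[ℂ] A where
  toFun a := a.1
  map_add' _ _ := rfl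
  map_smul' _ _ := rfl

variable {A}

theorem inclₗ_injective : Function.Injective (inclₗ A) := Subtype.val_injective

theorem bddAbove (a : BoundedElements A) :
    BddAbove (Set.range fun p : ContinuousCStarSeminorm A => p.1 (inclₗ A a)) := by
  obtain ⟨C, hC⟩ := a.2
  exact ⟨C, by rintro _ ⟨p, rfl⟩; exact hC p⟩

instance : Nonempty (ContinuousCStarSeminorm A) :=
  ⟨0, ⟨fun a b => by simp, fun a => by simp⟩, continuous_const⟩

noncomputable instance : Norm (BoundedElements A) :=
  ⟨fun a => ⨆ p : ContinuousCStarSeminorm A, p.1 (inclₗ A a)⟩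

theorem seminorm_le_norm (p : ContinuousCStarSeminorm A) (a : BoundedElements A) :
    p.1 (inclₗ A a) ≤ ‖a‖ :=
  le_ciSup (bddAbove a) p

theorem norm_le {a : BoundedElements A} {C : ℝ}
    (h : ∀ p : ContinuousCStarSeminorm A, p.1 (inclₗ A a) ≤ C) : ‖a‖ ≤ C :=
  ciSup_le h

theorem zero_le_norm (a : BoundedElements A) : 0 ≤ ‖a‖ :=
  Real.iSup_nonneg fun _ => apply_nonneg _ _

noncomputable instance : NormedAddCommGroup (BoundedElements A) :=
  AddGroupNorm.toNormedAddCommGroup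
    { toFun := fun a => ‖a‖
      map_zero' := by
        refine le_antisymm (norm_le fun p => ?_) (zero_le_norm _)
        rw [map_zero, map_zero]
      add_le' := fun a b => norm_le fun p => by
        rw [map_add]
        exact (map_add_le_add p.1 _ _).trans
          (add_le_add (seminorm_le_norm p a) (seminorm_le_norm p b))
      neg' := fun a => by
        change (⨆ p : ContinuousCStarSeminorm A, _) = ⨆ p : ContinuousCStarSeminorm A, _
        simp only [map_neg, map_neg_eq_map]
      eq_zero_of_map_eq_zero' := fun a h => by
        refine inclₗ_injective ?_
        rw [map_zero]
        exact ProCStarAlgebra.eq_zero fun p =>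
          le_antisymm ((seminorm_le_norm p a).trans h.le) (apply_nonneg _ _) }

noncomputable instance : NonUnitalNormedRing (BoundedElements A) :=
  { (inferInstance : NormedAddCommGroup (BoundedElements A)),
    (inferInstance : NonUnitalRing (BoundedElements A)) with
    norm_mul_le := fun a b => norm_le fun p => (p.2.1.mul_le _ _).trans
      (mul_le_mul (seminorm_le_norm p a) (seminorm_le_norm p b) (apply_nonneg _ _)
        (zero_le_norm a)) }

noncomputable instance : NormedSpace ℂ (BoundedElements A) where
  norm_smul_le c a := norm_le fun p => by
    rw [map_smul, map_smul_eq_mul]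
    exact mul_le_mul_of_nonneg_left (seminorm_le_norm p a) (norm_nonneg c)

instance : CStarRing (BoundedElements A) where
  norm_mul_self_le a := by
    have h : ‖a‖ ≤ Real.sqrt ‖star a * a‖ := norm_le fun p => by
      refine Real.le_sqrt_of_sq_le ?_
      rw [sq, ← p.2.1.star_mul_self]
      exact seminorm_le_norm p (star a * a)
    calc ‖a‖ * ‖a‖ ≤ Real.sqrt ‖star a * a‖ * Real.sqrt ‖star a * a‖ := by gcongr
      _ = ‖star a * a‖ := Real.mul_self_sqrt (norm_nonneg _)

variable (A) in
/-- The inclusion of the bounded elements, as a continuous linear map. -/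
noncomputable def incl : BoundedElements A →L[ℂ] A where
  toLinearMap := inclₗ A
  cont := by
    refine continuous_iff_continuousAt.2 fun a => ?_
    refine ProCStarAlgebra.tendsto_nhds.2 fun p => ?_
    have h : Tendsto (fun b : BoundedElements A => ‖b - a‖) (𝓝 a) (𝓝 0) := by
      have : Continuous fun b : BoundedElements A => ‖b - a‖ := by fun_prop
      simpa using this.tendsto a
    refine squeeze_zero (fun _ => apply_nonneg _ _) (fun b => ?_) h
    exact seminorm_le_norm p (b - a)

theorem seminorm_incl_le (p : ContinuousCStarSeminorm A) (a : BoundedElements A) :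
    p.1 (incl A a) ≤ ‖a‖ := seminorm_le_norm p a

theorem incl_mul (a b : BoundedElements A) : incl A (a * b) = incl A a * incl A b := rfl

theorem incl_star (a : BoundedElements A) : incl A (star a) = star (incl A a) := rfl

theorem denseRange_incl : DenseRange (incl A) := by
  have h : Set.range (incl A) = (boundedSubalgebra A : Set A) := Subtype.range_coe
  rw [DenseRange, h]
  exact dense_boundedSubalgebra

/-- A Cauchy sequence for the supremum norm converges in `A`. Its Cauchy estimates pass to the limit
with constants independent of `p`, so the limit is bounded and is attained in norm. -/
instance : CompleteSpace (BoundedElements A) := by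
  refine Metric.complete_of_cauchySeq_tendsto fun u hu => ?_
  obtain ⟨a, ha⟩ := cauchySeq_tendsto_of_complete
    (hu.map (incl A).uniformContinuous : CauchySeq fun n => incl A (u n))
  have key : ∀ ε > 0, ∃ N, ∀ n ≥ N, ∀ p : ContinuousCStarSeminorm A,
      p.1 (incl A (u n) - a) ≤ ε := by
    intro ε hε
    obtain ⟨N, hN⟩ := Metric.cauchySeq_iff.1 hu ε hε
    refine ⟨N, fun n hn p => ?_⟩
    have hlim : Tendsto (fun m => p.1 (incl A (u n) - incl A (u m))) atTop
        (𝓝 (p.1 (incl A (u n) - a))) :=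
      (p.2.2.tendsto _).comp (tendsto_const_nhds.sub ha)
    refine le_of_tendsto hlim (eventually_atTop.2 ⟨N, fun m hm => ?_⟩)
    rw [← map_sub]
    refine (seminorm_incl_le p _).trans ?_
    rw [← dist_eq_norm]
    exact (hN n hn m hm).le
  have hmem : a ∈ boundedSubalgebra A := by
    obtain ⟨N, hN⟩ := key 1 one_pos
    refine ⟨‖u N‖ + 1, fun p => ?_⟩
    have h1 := map_sub_le_add p.1 (incl A (u N)) (incl A (u N) - a)
    rw [sub_sub_cancel] at h1
    exact h1.trans (add_le_add (seminorm_incl_le p _) (hN N le_rfl p))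
  let b : BoundedElements A := ⟨a, hmem⟩
  refine ⟨b, Metric.tendsto_atTop.2 fun ε hε => ?_⟩
  obtain ⟨N, hN⟩ := key (ε / 2) (half_pos hε)
  refine ⟨N, fun n hn => ?_⟩
  rw [dist_eq_norm]
  refine lt_of_le_of_lt (norm_le fun p => ?_) (half_lt_self hε)
  rw [map_sub]
  exact hN n hn p

noncomputable instance : NonUnitalCStarAlgebra (BoundedElements A) where

noncomputable instance : PartialOrder (BoundedElements A) :=
  CStarAlgebra.spectralOrder (BoundedElements A)

instance : StarOrderedRing (BoundedElements A) :=
  CStarAlgebra.spectralOrderedRing (BoundedElements A)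

theorem eventually_norm_le_one :
    ∀ᶠ e in CStarAlgebra.approximateUnit (BoundedElements A), ‖e‖ ≤ 1 :=
  (CStarAlgebra.increasingApproximateUnit _).eventually_norm

/-- Approximate `a` by a bounded `b` in the seminorm `p`. The error stays small after multiplication
by `e`, since `p(e) ≤ ‖e‖ ≤ 1`. -/
theorem tendsto_mul_approximateUnit (a : A) :
    Tendsto (fun e => a * incl A e) (CStarAlgebra.approximateUnit (BoundedElements A)) (𝓝 a) := by
  refine ProCStarAlgebra.tendsto_nhds.2 fun p => ?_
  rw [Metric.tendsto_nhds]
  intro ε hε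
  have hb : ∃ b : BoundedElements A, p.1 (a - incl A b) < ε / 3 := by
    have ho : IsOpen {x : A | p.1 (a - x) < ε / 3} :=
      isOpen_lt (p.2.2.comp (continuous_const.sub continuous_id)) continuous_const
    exact denseRange_incl.exists_mem_open ho ⟨a, by simpa using by positivity⟩
  obtain ⟨b, hb⟩ := hb
  have h1 := (CStarAlgebra.increasingApproximateUnit (BoundedElements A)).tendsto_mul_left b
  filter_upwards [Metric.tendsto_nhds.1 h1 (ε / 3) (by positivity), eventually_norm_le_one]
    with e he he1
  rw [dist_zero_right, Real.norm_eq_abs, abs_of_nonneg (apply_nonneg _ _)]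
  rw [dist_eq_norm] at he
  have h2 : a * incl A e - a = (a - incl A b) * incl A e + incl A (b * e - b)
      - (a - incl A b) := by
    rw [map_sub, incl_mul, sub_mul]; abel
  have h3 : p.1 ((a - incl A b) * incl A e) ≤ p.1 (a - incl A b) := by
    refine (p.2.1.mul_le _ _).trans (mul_le_of_le_one_right (apply_nonneg _ _) ?_)
    exact (seminorm_incl_le p e).trans he1
  have h4 := seminorm_incl_le p (b * e - b)
  have h5 := map_sub_le_add p.1 ((a - incl A b) * incl A e + incl A (b * e - b)) (a - incl A b)
  have h6 := map_add_le_add p.1 ((a - incl A b) * incl A e) (incl A (b * e - b))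
  rw [h2]
  linarith

theorem tendsto_approximateUnit_mul (a : A) :
    Tendsto (fun e => incl A e * a) (CStarAlgebra.approximateUnit (BoundedElements A)) (𝓝 a) := by
  have h := (continuous_star.tendsto _).comp (tendsto_mul_approximateUnit (star a))
  rw [star_star] at h
  refine h.congr' ?_
  filter_upwards [(CStarAlgebra.increasingApproximateUnit (BoundedElements A)).eventually_star_eq]
    with e he
  simp only [Function.comp, star_mul, star_star, ← incl_star, he]

end BoundedElements

end BoundedElements

/-! ### Domination of a continuous functional by `a ↦ K p(a c)`. -/

section Factorization

open Filter

/-- By the C*-identity, `‖g(z) c‖² = ‖g(z) c c* g(z)‖ ≤ ‖g(z) z g(z)‖`, and the functional calculus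
bounds the last norm. -/
theorem CStarAlgebra.norm_cfc_mul_le {U : Type*} [CStarAlgebra U] [PartialOrder U]
    [StarOrderedRing U] {z c : U} (hz : 0 ≤ z) (hcz : c * star c ≤ z) {g : ℝ → ℝ}
    (hg : Continuous g) {K : ℝ} (hK : 0 ≤ K) (h : ∀ t, 0 ≤ t → g t * t * g t ≤ K * K) :
    ‖cfc g z * c‖ ≤ K := by
  have hsa : star (cfc g z) = cfc g z := (cfc_predicate g z : IsSelfAdjoint _).star_eq
  have h1 : (cfc g z * c) * star (cfc g z * c) = cfc g z * (c * star c) * star (cfc g z) := by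
    rw [star_mul]; simp only [mul_assoc]
  have h2 : cfc g z * z * star (cfc g z) = cfc (fun t => g t * t * g t) z := by
    rw [hsa, cfc_mul (fun t => g t * t) g z, cfc_mul g (fun t => t) z, cfc_id' ℝ z]
  have h3 : ‖cfc (fun t => g t * t * g t) z‖ ≤ K * K := by
    refine norm_cfc_le (by positivity) fun t ht => ?_
    have ht0 : 0 ≤ t := spectrum_nonneg_of_nonneg hz ht
    rw [Real.norm_eq_abs, abs_of_nonneg]
    · exact h t ht0
    · have : g t * t * g t = t * (g t * g t) := by ring
      rw [this]
      exact mul_nonneg ht0 (mul_self_nonneg _)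
  have h4 : ‖(cfc g z * c) * star (cfc g z * c)‖ ≤ K * K := by
    refine le_trans ?_ h3
    rw [← h2, h1]
    refine CStarAlgebra.norm_le_norm_of_nonneg_of_le ?_ (star_right_conjugate_le_conjugate hcz _)
    exact star_right_conjugate_nonneg (mul_star_self_nonneg c) _
  rw [CStarRing.norm_self_mul_star] at h4
  exact abs_le_of_sq_le_sq' (by nlinarith) hK |>.2

/-- If `c c* ≤ z`, then `c` lies in the closure of `√z` times the unit ball. -/
theorem CStarAlgebra.exists_norm_sub_sqrt_mul_le {B : Type*} [NonUnitalCStarAlgebra B]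
    [PartialOrder B] [StarOrderedRing B] {z c : B} (hz : 0 ≤ z) (hcz : c * star c ≤ z)
    {ε : ℝ} (hε : 0 < ε) : ∃ w : B, ‖w‖ ≤ 1 ∧ ‖c - cfcₙ Real.sqrt z * w‖ ≤ ε := by
  -- A continuous regularization of `1/√t`. For `t ≥ 0` both `t g(t)² ≤ 1` and `t (1 - √t g(t))² ≤
  -- ε²` hold, which give the two required estimates for `w = g(z) c`.
  let g : ℝ → ℝ := fun t => Real.sqrt t / (|t| + ε ^ 2)
  have hpos : ∀ t : ℝ, 0 < |t| + ε ^ 2 := fun t => by positivity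
  have hg : Continuous g := Real.continuous_sqrt.div (by fun_prop) fun t => (hpos t).ne'
  have hg0 : g 0 = 0 := by simp [g]
  have hz' : 0 ≤ (z : Unitization ℂ B) := Unitization.inr_nonneg_iff.2 hz
  have hcz' : (c : Unitization ℂ B) * star (c : Unitization ℂ B) ≤ z := by
    rw [← Unitization.inr_star, ← Unitization.inr_mul,
      Unitization.inr_le_iff _ _ (.mul_star_self c) (.of_nonneg hz)]
    exact hcz
  refine ⟨cfcₙ g z * c, ?_, ?_⟩
  · rw [← Unitization.norm_inr (𝕜 := ℂ), Unitization.inr_mul,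
      Unitization.real_cfcₙ_eq_cfc_inr z g hg0]
    refine CStarAlgebra.norm_cfc_mul_le hz' hcz' hg zero_le_one fun t ht => ?_
    have h1 := hpos t
    have h2 := Real.mul_self_sqrt ht
    have : g t * t * g t = (t / (|t| + ε ^ 2)) * (t / (|t| + ε ^ 2)) := by
      simp only [g]
      field_simp
      rw [Real.sq_sqrt ht]
      ring
    rw [this]
    rw [abs_of_nonneg ht] at *
    have h3 : t / (t + ε ^ 2) ≤ 1 := div_le_one_of_le₀ (by nlinarith [sq_nonneg ε]) h1.le
    have h4 : 0 ≤ t / (t + ε ^ 2) := by positivity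
    nlinarith
  · have h1 : ((c - cfcₙ Real.sqrt z * (cfcₙ g z * c) : B) : Unitization ℂ B) =
        cfc (fun t => 1 - Real.sqrt t * g t) (z : Unitization ℂ B) * c := by
      rw [cfc_sub (fun _ => (1 : ℝ)) (fun t => Real.sqrt t * g t) (z : Unitization ℂ B),
        cfc_const_one ℝ (z : Unitization ℂ B),
        cfc_mul Real.sqrt g (z : Unitization ℂ B), sub_mul, one_mul, Unitization.inr_sub,
        Unitization.inr_mul, Unitization.inr_mul, Unitization.real_cfcₙ_eq_cfc_inr z g hg0,
        Unitization.real_cfcₙ_eq_cfc_inr z Real.sqrt Real.sqrt_zero, mul_assoc]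
    rw [← Unitization.norm_inr (𝕜 := ℂ), h1]
    refine CStarAlgebra.norm_cfc_mul_le hz' hcz' (by fun_prop) hε.le fun t ht => ?_
    have h0 := hpos t
    have h2 : 1 - Real.sqrt t * g t = ε ^ 2 / (|t| + ε ^ 2) := by
      simp only [g]
      rw [mul_div_assoc', Real.mul_self_sqrt ht, abs_of_nonneg ht, eq_div_iff (by positivity)]
      rw [sub_mul, div_mul_cancel₀ _ (by positivity)]
      ring
    rw [h2, abs_of_nonneg ht, div_mul_eq_mul_div, div_mul_div_comm, div_le_iff₀ (by positivity)]
    nlinarith [mul_nonneg ht ht, pow_pos hε 2, pow_pos hε 6, mul_nonneg ht (pow_pos hε 4).le,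
      mul_nonneg (mul_nonneg ht ht) (pow_pos hε 2).le]

variable {A : Type*} [NonUnitalRing A] [StarRing A] [Module ℂ A]

/-- A Pythagorean inequality, from expanding `(a + d)(a + d)*`: the cross term is small when `d a*`
is. -/
theorem IsCStarSeminorm.sq_add_le {p : Seminorm ℂ A} (hp : IsCStarSeminorm p) (a d : A) :
    p (a + d) ^ 2 ≤ p a ^ 2 + 2 * p (d * star a) + p d ^ 2 := by
  have h1 : (a + d) * star (a + d) =
      (a * star a + star (d * star a)) + (d * star a + d * star d) := by
    rw [star_add, mul_add, add_mul, add_mul, star_mul, star_star]; abel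
  have h2 := map_add_le_add p (a * star a + star (d * star a)) (d * star a + d * star d)
  have h3 := map_add_le_add p (a * star a) (star (d * star a))
  have h4 := map_add_le_add p (d * star a) (d * star d)
  rw [← h1, hp.mul_star_self] at h2
  rw [hp.mul_star_self, hp.map_star] at h3
  rw [hp.mul_star_self] at h4
  nlinarith

variable [IsScalarTower ℂ A A] [SMulCommClass ℂ A A] [StarModule ℂ A] [UniformSpace A]
  [ProCStarAlgebra A]

open BoundedElements

theorem IsCStarSeminorm.sub_mul_le (p : ContinuousCStarSeminorm A) (b : A)
    {e : BoundedElements A} (he : ‖e‖ ≤ 1) : p.1 (b - b * incl A e) ≤ 2 * p.1 b := by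
  have h1 := map_sub_le_add p.1 b (b * incl A e)
  have h2 : p.1 (b * incl A e) ≤ p.1 b :=
    (p.2.1.mul_le _ _).trans
      (mul_le_of_le_one_right (apply_nonneg _ _) ((seminorm_incl_le p e).trans he))
  linarith

/-- Multiplying a continuous functional by the approximate unit recovers it in norm. -/
theorem eventually_functional_sub_mul_le (p : ContinuousCStarSeminorm A) (f : A →ₗ[ℂ] ℂ) {C : ℝ}
    (hC : 0 ≤ C) (hf : ∀ a, ‖f a‖ ≤ C * p.1 a) {η : ℝ} (hη : 0 < η) :
    ∀ᶠ e in CStarAlgebra.approximateUnit (BoundedElements A), ∀ b,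
      ‖f (b - b * incl A e)‖ ≤ η * p.1 b := by
  -- The supremum `N` of `S` is the norm of `f` relative to `p`. At a near-maximizer `a`, the
  -- functional must be small on every `d = b - b e` in play, since `d a* = b (a* - e a*)` is small
  -- and adding a multiple of `d` to `a` hardly increases the seminorm.
  let S : Set ℝ := (fun a => ‖f a‖) '' {a | p.1 a ≤ 1}
  have hSne : S.Nonempty := ⟨_, 0, by simp, rfl⟩
  have hSb : BddAbove S := by
    refine ⟨C, ?_⟩
    rintro _ ⟨a, ha, rfl⟩
    exact (hf a).trans (mul_le_of_le_one_right hC ha)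
  set N := sSup S with hN
  have hN0 : 0 ≤ N := by
    have := le_csSup hSb ⟨0, by simp, rfl⟩
    exact (norm_nonneg _).trans this
  have hzero : ∀ a, p.1 a = 0 → f a = 0 := fun a ha => by
    have := hf a
    rw [ha, mul_zero] at this
    exact norm_le_zero_iff.1 this
  have hscale : ∀ (g : A →ₗ[ℂ] ℂ) (K : ℝ), (∀ a, p.1 a = 0 → g a = 0) →
      (∀ a, p.1 a ≤ 1 → ‖g a‖ ≤ K) → ∀ a, ‖g a‖ ≤ K * p.1 a := by
    intro g K h0 h1 a
    rcases (apply_nonneg p.1 a).eq_or_lt with h | h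
    · rw [h0 a h.symm, ← h]; simp
    · have h2 : p.1 (((p.1 a)⁻¹ : ℝ) • a : A) ≤ 1 := by
        rw [← Complex.coe_smul, map_smul_eq_mul, Complex.norm_real, norm_inv, Real.norm_eq_abs,
          abs_of_pos h, inv_mul_cancel₀ h.ne']
      have h3 := h1 _ h2
      rw [← Complex.coe_smul, map_smul, norm_smul, Complex.norm_real, norm_inv, Real.norm_eq_abs,
          abs_of_pos h, inv_mul_le_iff₀ h] at h3
      linarith
  have hfN : ∀ a, ‖f a‖ ≤ N * p.1 a :=
    hscale f N hzero fun a ha => le_csSup hSb ⟨a, ha, rfl⟩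
  -- Chosen so that `N - t² + t|f(d)| ≤ N(1 + 3t²)` gives `|f(d)| ≤ t(1 + 3N) = η`.
  set t := η / (1 + 3 * N) with ht
  have ht0 : 0 < t := by positivity
  obtain ⟨_, ⟨a, ha, rfl⟩, haN⟩ : ∃ s ∈ S, N - t ^ 2 < s :=
    exists_lt_of_lt_csSup hSne (by linarith [pow_pos ht0 2])
  change p.1 a ≤ 1 at ha
  change N - t ^ 2 < ‖f a‖ at haN
  have h1 := ProCStarAlgebra.tendsto_nhds.1 (tendsto_approximateUnit_mul (star a)) p
  filter_upwards [eventually_norm_le_one, h1.eventually (gt_mem_nhds ht0)] with e he he2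
  have hd0 : ∀ b, p.1 b = 0 → p.1 (b - b * incl A e) = 0 := fun b hb =>
    le_antisymm ((IsCStarSeminorm.sub_mul_le p b he).trans (by simp [hb])) (apply_nonneg _ _)
  refine hscale (f ∘ₗ (LinearMap.id - LinearMap.mulRight ℂ (incl A e))) η
    (fun b hb => hzero _ (hd0 b hb)) fun b hb => ?_
  change ‖f (b - b * incl A e)‖ ≤ η
  set d := b - b * incl A e with hd
  have hda : p.1 (d * star a) ≤ t := by
    have : d * star a = -(b * (incl A e * star a - star a)) := by
      rw [hd, sub_mul, mul_sub, mul_assoc]; abel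
    rw [this, map_neg_eq_map]
    exact (p.2.1.mul_le _ _).trans
      ((mul_le_of_le_one_left (apply_nonneg _ _) hb).trans he2.le)
  have hd2 : p.1 d ≤ 2 := (IsCStarSeminorm.sub_mul_le p b he).trans (by linarith)
  -- Unimodular phases make the values of `f` at `a` and `d` add without cancellation.
  obtain ⟨u, hu, hua⟩ := RCLike.exists_norm_eq_mul_self (f a)
  obtain ⟨v, hv, hvd⟩ := RCLike.exists_norm_eq_mul_self (f d)
  have hfz : f (u • a + ((t : ℂ) * v) • d) = ((‖f a‖ + t * ‖f d‖ : ℝ) : ℂ) := by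
    rw [map_add, map_smul, map_smul, smul_eq_mul, smul_eq_mul, mul_assoc, ← hvd, ← hua]
    push_cast
    rfl
  have h2 := hfN (u • a + ((t : ℂ) * v) • d)
  rw [hfz, Complex.norm_real, Real.norm_eq_abs, abs_of_nonneg (by positivity)] at h2
  have h3 := p.2.1.sq_add_le (u • a) (((t : ℂ) * v) • d)
  have h4 : ‖(t : ℂ)‖ = t := by rw [Complex.norm_real, Real.norm_eq_abs, abs_of_pos ht0]
  rw [star_smul, smul_mul_smul_comm, map_smul_eq_mul, map_smul_eq_mul, map_smul_eq_mul, norm_mul,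
    norm_mul, norm_star, hu, hv, h4] at h3
  have h5 : p.1 (u • a + ((t : ℂ) * v) • d) ≤ 1 + 3 * t ^ 2 := by
    refine abs_le_of_sq_le_sq' (h3.trans ?_) (by positivity) |>.2
    have ha2 : p.1 a ^ 2 ≤ 1 := pow_le_one₀ (apply_nonneg _ _) ha
    have hd22 : p.1 d ^ 2 ≤ 4 := by
      have := pow_le_pow_left₀ (apply_nonneg p.1 d) hd2 2
      linarith
    have h6 : t * p.1 (d * star a) ≤ t * t := by gcongr
    have h7 : t ^ 2 * p.1 d ^ 2 ≤ t ^ 2 * 4 := by gcongr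
    nlinarith [pow_pos ht0 4]
  have h6 : N * p.1 (u • a + ((t : ℂ) * v) • d) ≤ N * (1 + 3 * t ^ 2) := by gcongr
  have h7 : t * ‖f d‖ ≤ t * (t * (1 + 3 * N)) := by nlinarith
  have h8 := le_of_mul_le_mul_left h7 ht0
  rwa [ht, div_mul_cancel₀ _ (by positivity)] at h8

theorem seminorm_mul_le_seminorm_mul_sqrt (p : ContinuousCStarSeminorm A)
    {z c : BoundedElements A} (hz : 0 ≤ z) (hcz : c * star c ≤ z) (a : A) :
    p.1 (a * incl A c) ≤ p.1 (a * incl A (cfcₙ Real.sqrt z)) := by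
  refine le_of_forall_pos_le_add fun δ hδ => ?_
  have hε : 0 < δ / (p.1 a + 1) := div_pos hδ (by linarith [apply_nonneg p.1 a])
  obtain ⟨w, hw, hcw⟩ := CStarAlgebra.exists_norm_sub_sqrt_mul_le hz hcz hε
  have h1 : a * incl A c = a * incl A (cfcₙ Real.sqrt z) * incl A w +
      a * incl A (c - cfcₙ Real.sqrt z * w) := by
    rw [map_sub, incl_mul, mul_sub, mul_assoc]; abel
  rw [h1]
  refine (map_add_le_add p.1 _ _).trans (add_le_add ?_ ?_)
  · exact (p.2.1.mul_le _ _).trans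
      (mul_le_of_le_one_right (apply_nonneg _ _) ((seminorm_incl_le p w).trans hw))
  · refine (p.2.1.mul_le _ _).trans ?_
    have h2 := (seminorm_incl_le p _).trans hcw
    have h3 := apply_nonneg p.1 a
    calc p.1 a * p.1 (incl A (c - cfcₙ Real.sqrt z * w))
        ≤ (p.1 a + 1) * (δ / (p.1 a + 1)) := by gcongr; linarith
      _ = δ := mul_div_cancel₀ _ (by linarith)

/-- A functional bounded by a C*-seminorm `p` is bounded by `a ↦ p (a c)` for some `c`. -/
theorem exists_functional_le_seminorm_mul (p : ContinuousCStarSeminorm A) (f : A →ₗ[ℂ] ℂ) {C : ℝ}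
    (hC : 0 < C) (hf : ∀ a, ‖f a‖ ≤ C * p.1 a) :
    ∃ c : A, ∀ a, ‖f a‖ ≤ 2 * C * p.1 (a * c) := by
  have step : ∀ (n : ℕ) (g : A →ₗ[ℂ] ℂ), (∀ b, ‖g b‖ ≤ C / 4 ^ n * p.1 b) →
      ∃ e : BoundedElements A, ‖e‖ ≤ 1 ∧ ∀ b, ‖g (b - b * incl A e)‖ ≤ C / 4 ^ (n + 1) * p.1 b := by
    intro n g hg
    exact (eventually_norm_le_one.and
      (eventually_functional_sub_mul_le p g (by positivity) hg (by positivity))).exists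
  choose! E hE1 hE2 using step
  -- Successive remainders, of norm at most `C/4ⁿ` relative to `p`, so that `f(a)` is the sum of the
  -- `F n (a e_n)`.
  let F : ℕ → (A →ₗ[ℂ] ℂ) := fun n => Nat.rec f
    (fun n g => g ∘ₗ (LinearMap.id - LinearMap.mulRight ℂ (incl A (E n g)))) n
  have hF : ∀ n b, ‖F n b‖ ≤ C / 4 ^ n * p.1 b := by
    intro n
    induction n with
    | zero => simpa [F] using hf
    | succ n ih => exact hE2 n (F n) ih
  let e : ℕ → BoundedElements A := fun n => E n (F n)
  have he : ∀ n, ‖e n‖ ≤ 1 := fun n => hE1 n (F n) (hF n)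
  have hsucc : ∀ n a, F (n + 1) a = F n a - F n (a * incl A (e n)) := fun n a =>
    map_sub (F n) a (a * incl A (e n))
  -- The decay `4⁻ⁿ` is shared: one factor `2⁻ⁿ` makes `∑ c_n c_n*` converge, the other makes the
  -- bounds on `F n (a e_n)` summable. The square root of that sum dominates every `c_n` at once.
  let c : ℕ → BoundedElements A := fun n => ((1 / 2 : ℂ) ^ n) • e n
  have hc : ∀ n, ‖c n‖ ≤ (1 / 2 : ℝ) ^ n := fun n => by
    simp only [c, norm_smul, norm_pow, norm_div, norm_one, Complex.norm_ofNat]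
    exact mul_le_of_le_one_right (by positivity) (he n)
  have hsum : Summable fun n => c n * star (c n) := by
    refine Summable.of_norm_bounded (g := fun n => (1 / 4 : ℝ) ^ n)
      (summable_geometric_of_lt_one (by norm_num) (by norm_num)) fun n => ?_
    rw [CStarRing.norm_self_mul_star]
    calc ‖c n‖ * ‖c n‖ ≤ (1 / 2 : ℝ) ^ n * (1 / 2 : ℝ) ^ n := by gcongr <;> exact hc n
      _ = (1 / 4 : ℝ) ^ n := by rw [← mul_pow]; norm_num
  have hz : 0 ≤ ∑' n, c n * star (c n) := tsum_nonneg fun n => mul_star_self_nonneg _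
  set s := incl A (cfcₙ Real.sqrt (∑' n, c n * star (c n))) with hs
  have hterm : ∀ n a, ‖F n (a * incl A (e n))‖ ≤ C * p.1 (a * s) * (1 / 2) ^ n := by
    intro n a
    have h1 := seminorm_mul_le_seminorm_mul_sqrt p hz
      (hsum.le_tsum n fun m _ => mul_star_self_nonneg (c m)) a
    have h2 : a * incl A (c n) = ((1 / 2 : ℂ) ^ n) • (a * incl A (e n)) := by
      rw [map_smul, mul_smul_comm]
    rw [h2, map_smul_eq_mul, norm_pow, norm_div, norm_one, Complex.norm_ofNat] at h1
    refine (hF n _).trans ?_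
    have h3 : C / 4 ^ n * p.1 (a * incl A (e n)) =
        C * ((1 / 2) ^ n * p.1 (a * incl A (e n))) * (1 / 2) ^ n := by
      have : (1 / 4 : ℝ) ^ n = (1 / 2) ^ n * (1 / 2) ^ n := by rw [← mul_pow]; norm_num
      rw [div_eq_mul_one_div, ← one_div_pow, this]
      ring
    rw [h3]
    gcongr
  have htel : ∀ n a, ‖f a‖ ≤ ∑ k ∈ Finset.range n, C * p.1 (a * s) * (1 / 2) ^ k + ‖F n a‖ := by
    intro n a
    induction n with
    | zero => simp [F]
    | succ n ih =>
      rw [Finset.sum_range_succ]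
      have h1 : F n a = F n (a * incl A (e n)) + F (n + 1) a := by rw [hsucc]; ring
      have h2 := norm_add_le (F n (a * incl A (e n))) (F (n + 1) a)
      rw [← h1] at h2
      have := hterm n a
      linarith
  refine ⟨s, fun a => ?_⟩
  have hlim : Tendsto (fun n : ℕ => 2 * C * p.1 (a * s) + C * p.1 a * (1 / 4) ^ n) atTop
      (𝓝 (2 * C * p.1 (a * s))) := by
    simpa using (tendsto_pow_atTop_nhds_zero_of_lt_one (r := (1 / 4 : ℝ)) (by norm_num)
      (by norm_num)).const_mul (C * p.1 a) |>.const_add (2 * C * p.1 (a * s))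
  refine ge_of_tendsto' hlim fun n => (htel n a).trans (add_le_add ?_ ?_)
  · rw [← Finset.mul_sum]
    have h1 : ∑ k ∈ Finset.range n, (1 / 2 : ℝ) ^ k ≤ 2 := by
      have := summable_geometric_two.sum_le_tsum (Finset.range n) fun _ _ => by positivity
      rwa [tsum_geometric_two] at this
    have h2 : 0 ≤ C * p.1 (a * s) := mul_nonneg hC.le (apply_nonneg _ _)
    nlinarith
  · refine (hF n a).trans_eq ?_
    rw [one_div_pow]; ring

end Factorization

/-! ### Bounded localization and a criterion for embeddings of strong duals. -/

section Localization

open Filter Bornology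

variable {E F : Type*} [AddCommGroup E] [Module ℂ E] [AddCommGroup F] [Module ℂ F]

/-- The closure condition gives `sup_S |f| ≤ sup_R |f ∘ T|`, so the seminorms defining the strong
topology are controlled from `E`. Singletons `S` give injectivity. -/
theorem Topology.isEmbedding_precomp_of_forall_bounded [TopologicalSpace E] [TopologicalSpace F]
    [ContinuousSMul ℂ F] (T : E →L[ℂ] F)
    (h : ∀ S : Set F, IsVonNBounded ℂ S → ∃ R : Set E, IsVonNBounded ℂ R ∧
      ∀ f : StrongDual ℂ F, ∀ x ∈ S, f x ∈ closure ((fun a => f (T a)) '' R)) :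
    IsEmbedding (ContinuousLinearMap.precomp ℂ T : StrongDual ℂ F →L[ℂ] StrongDual ℂ E) := by
  refine ⟨?_, ?_⟩
  · rw [IsTopologicalAddGroup.isInducing_iff_nhds_zero]
    refine le_antisymm ?_ ?_
    · rw [← map_le_iff_le_comap]
      exact (ContinuousLinearMap.precomp ℂ T).continuous.tendsto' 0 0 (map_zero _)
    · rw [(ContinuousLinearMap.hasBasis_nhds_zero_of_basis
        (Metric.nhds_basis_closedBall (x := (0 : ℂ)))).ge_iff]
      rintro ⟨S, ε⟩ ⟨hS, hε⟩
      obtain ⟨R, hR, hRS⟩ := h S hS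
      refine mem_comap.2 ⟨_, (ContinuousLinearMap.hasBasis_nhds_zero_of_basis
        (Metric.nhds_basis_closedBall (x := (0 : ℂ)))).mem_of_mem (i := (R, ε)) ⟨hR, hε⟩, ?_⟩
      intro f hf x hx
      refine closure_minimal ?_ Metric.isClosed_closedBall (hRS f x hx)
      rintro _ ⟨a, ha, rfl⟩
      exact hf a ha
  · rw [injective_iff_map_eq_zero]
    intro f hf
    ext x
    obtain ⟨R, -, hRS⟩ := h {x} (isVonNBounded_singleton x)
    have hx := hRS f x rfl
    have hsub : (fun a => f (T a)) '' R ⊆ {0} := by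
      rintro _ ⟨a, -, rfl⟩
      exact DFunLike.congr_fun hf a
    exact closure_minimal hsub isClosed_singleton hx

theorem IsLocallyConvexTopology.induced {θ : TopologicalSpace F} (hθ : IsLocallyConvexTopology θ)
    (L : E →ₗ[ℂ] F) : IsLocallyConvexTopology (θ.induced L) := by
  have := hθ.addGroup
  have := hθ.smul
  have := hθ.locallyConvex
  exact ⟨topologicalAddGroup_induced L, continuousSMul_induced L,
    LocallyConvexSpace.induced (L.restrictScalars ℝ)⟩

theorem IsLocallyConvexTopology.inf {σ θ : TopologicalSpace E} (hσ : IsLocallyConvexTopology σ)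
    (hθ : IsLocallyConvexTopology θ) : IsLocallyConvexTopology (σ ⊓ θ) :=
  ⟨topologicalAddGroup_inf hσ.addGroup hθ.addGroup, @continuousSMul_inf _ _ _ _ _ _ hσ.smul hθ.smul,
    LocallyConvexSpace.inf hσ.locallyConvex hθ.locallyConvex⟩

theorem localized_le {σ : TopologicalSpace E} (hσ : IsLocallyConvexTopology σ) :
    localized σ ≤ σ :=
  sInf_le ⟨hσ, fun _ _ => rfl⟩

theorem IsLocallyConvexTopology.localized {σ : TopologicalSpace E}
    (hσ : IsLocallyConvexTopology σ) : IsLocallyConvexTopology (localized σ) :=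
  (isLeast_localized hσ).1.1

theorem tendsto_localized {σ : TopologicalSpace E} (hσ : IsLocallyConvexTopology σ)
    {D : Set E} (hD : IsBoundedFor σ D) {ι : Type*} {l : Filter ι} {u : ι → E} {a : E}
    (hu : ∀ᶠ i in l, u i ∈ D) (ha : a ∈ D) (h : Tendsto u l (@nhds E σ a)) :
    Tendsto u l (@nhds E (localized σ) a) := by
  classical
  have hind := (isLeast_localized hσ).1.2 D hD
  let v : ι → D := fun i => if hi : u i ∈ D then ⟨u i, hi⟩ else ⟨a, ha⟩
  have huv : ∀ᶠ i in l, (v i : E) = u i := hu.mono fun i hi => by simp [v, hi]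
  have h1 : Tendsto v l (@nhds D (σ.induced Subtype.val) ⟨a, ha⟩) := by
    rw [@nhds_induced, tendsto_comap_iff]
    exact h.congr' (huv.mono fun i hi => hi.symm)
  rw [← hind, @nhds_induced, tendsto_comap_iff] at h1
  exact h1.congr' huv

/-- Boundedness is tested on null sequences `ε_n x_n` with `x_n` in `S`. Such a sequence together
with `0` is a `σ`-bounded set, on which `σ` and `σ_b` agree. -/
theorem isBoundedFor_localized {σ : TopologicalSpace E} (hσ : IsLocallyConvexTopology σ)
    {S : Set E} (hS : IsBoundedFor σ S) : IsBoundedFor (localized σ) S := by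
  let ε : ℕ → ℂ := fun n => ((1 / ((n : ℝ) + 1) : ℝ) : ℂ)
  have hε : Tendsto ε atTop (𝓝 0) :=
    (Complex.continuous_ofReal.tendsto' 0 0 Complex.ofReal_zero).comp
      tendsto_one_div_add_atTop_nhds_zero_nat
  have := hσ.smul
  have := hσ.addGroup
  refine @isVonNBounded_of_smul_tendsto_zero ℂ E ℕ _ _ _ (localized σ) hσ.localized.smul ε atTop _
    (Eventually.of_forall fun n => ?_) S fun x hx => ?_
  · exact Complex.ofReal_ne_zero.2 (by positivity)
  · have h1 : Tendsto (ε • x) atTop (@nhds E σ 0) :=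
      IsVonNBounded.smul_tendsto_zero hS (Eventually.of_forall hx) hε
    have h2 : IsBoundedFor σ (insert 0 (Set.range (ε • x))) :=
      (isVonNBounded_insert (0 : E)).2 (h1.isVonNBounded_range ℂ)
    exact tendsto_localized hσ h2
      (Eventually.of_forall fun n => Set.mem_insert_of_mem _ (Set.mem_range_self n))
      (Set.mem_insert _ _) h1

theorem IsBoundedFor.image {σ : TopologicalSpace E} {θ : TopologicalSpace F} {S : Set E}
    (hS : IsBoundedFor σ S) {L : E →ₗ[ℂ] F} (hL : Continuous[σ, θ] L) :
    IsBoundedFor θ (L '' S) :=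
  IsVonNBounded.image (E := E) (F := F) (σ := RingHom.id ℂ) hS ⟨L, hL⟩

theorem isBoundedFor_singleton {σ : TopologicalSpace E} (hσ : IsLocallyConvexTopology σ) (x : E) :
    IsBoundedFor σ {x} :=
  have := hσ.smul
  isVonNBounded_singleton x

theorem IsBoundedFor.insert {σ : TopologicalSpace E} (hσ : IsLocallyConvexTopology σ) {S : Set E}
    (hS : IsBoundedFor σ S) (x : E) : IsBoundedFor σ (insert x S) :=
  have := hσ.smul
  have := hσ.addGroup
  (isVonNBounded_insert x).2 hS

theorem IsLocallyConvexTopology.continuous_of_tendsto_zero {σ : TopologicalSpace E}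
    (hσ : IsLocallyConvexTopology σ) {L : E →ₗ[ℂ] ℂ} (hL : Tendsto L (@nhds E σ 0) (𝓝 0)) :
    Continuous[σ, inferInstance] L :=
  have := hσ.addGroup
  continuous_of_continuousAt_zero L (by rwa [ContinuousAt, map_zero])

/-- Since `L` preserves bounded sets, the infimum of `σ` and the pullback of `θ_b` agrees with `σ`
on `σ`-bounded sets, hence is coarser than `σ_b`. -/
theorem continuous_localized {σ : TopologicalSpace E} {θ : TopologicalSpace F}
    (hσ : IsLocallyConvexTopology σ) (hθ : IsLocallyConvexTopology θ) (L : E →ₗ[ℂ] F)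
    (hL : Continuous[σ, θ] L) : Continuous[localized σ, localized θ] L := by
  rw [continuous_iff_le_induced]
  refine le_trans (sInf_le ⟨hσ.inf (hθ.localized.induced L), fun S hS => ?_⟩)
    (inf_le_right (a := σ))
  rw [induced_inf, inf_eq_left]
  have hLS : IsBoundedFor θ (L '' S) := hS.image hL
  let r : S → L '' S := fun x => ⟨L x, x, x.2, rfl⟩
  have h1 : ∀ t : TopologicalSpace F, (t.induced L).induced (Subtype.val : S → E) =
      (t.induced (Subtype.val : L '' S → F)).induced r := fun t => by
    rw [induced_compose, induced_compose]; rfl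
  rw [h1, (isLeast_localized hθ).1.2 _ hLS, ← h1]
  exact induced_mono (continuous_iff_le_induced.1 hL)

end Localization

/-! ### Strict approximation and strict extension of functionals. -/

section Multipliers

open Filter Bornology BoundedElements

theorem IsCStarSeminorm.sup {A : Type*} [NonUnitalRing A] [StarRing A] [Module ℂ A]
    {p q : Seminorm ℂ A} (hp : IsCStarSeminorm p)
    (hq : IsCStarSeminorm q) : IsCStarSeminorm (p ⊔ q) where
  mul_le a b := by
    have h1 : 0 ≤ p a := apply_nonneg _ _
    have h2 : 0 ≤ q a := apply_nonneg _ _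
    have h3 : 0 ≤ p b := apply_nonneg _ _
    have h4 : 0 ≤ q b := apply_nonneg _ _
    simp only [Seminorm.sup_apply]
    refine sup_le ((hp.mul_le a b).trans ?_) ((hq.mul_le a b).trans ?_)
    · exact mul_le_mul le_sup_left le_sup_left h3 (h1.trans le_sup_left)
    · exact mul_le_mul le_sup_right le_sup_right h4 (h1.trans le_sup_left)
  star_mul_self a := by
    have h1 : 0 ≤ p a := apply_nonneg _ _
    have h2 : 0 ≤ q a := apply_nonneg _ _
    simp only [Seminorm.sup_apply, hp.star_mul_self, hq.star_mul_self]
    rcases le_total (p a) (q a) with h | h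
    · rw [sup_eq_right.2 h, sup_eq_right.2 (mul_self_le_mul_self h1 h)]
    · rw [sup_eq_left.2 h, sup_eq_left.2 (mul_self_le_mul_self h2 h)]

theorem ContinuousCStarSeminorm.exists_finset_sup_le {A : Type*} [NonUnitalRing A] [StarRing A]
    [Module ℂ A] [UniformSpace A] (s : Finset (ContinuousCStarSeminorm A)) :
    ∃ q : ContinuousCStarSeminorm A, s.sup (fun p => p.1) ≤ q.1 := by
  classical
  induction s using Finset.induction_on with
  | empty => exact ⟨⟨0, ⟨fun a b => by simp, fun a => by simp⟩, continuous_const⟩, by simp⟩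
  | insert p s _ ih =>
    obtain ⟨q, hq⟩ := ih
    refine ⟨⟨p.1 ⊔ q.1, p.2.1.sup q.2.1, ?_⟩, ?_⟩
    · exact p.2.2.sup q.2.2
    · rw [Finset.sup_insert]
      exact sup_le_sup le_rfl hq

variable {A : Type*} [NonUnitalRing A] [StarRing A] [Module ℂ A] [IsScalarTower ℂ A A]
  [SMulCommClass ℂ A A] [StarModule ℂ A] [UniformSpace A] [ProCStarAlgebra A]

variable (A) in
theorem isLocallyConvexTopology_proTopology : IsLocallyConvexTopology (proTopology A) :=
  ⟨inferInstance, inferInstance,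
    (ProCStarAlgebra.withSeminorms (A := A)).toLocallyConvexSpace⟩

/-- A multiplier, as the function `a ↦ (l a, r a)`. -/
def multiplierEval : multiplierAlgebra A →ₗ[ℂ] A → A × A where
  toFun x a := (x.1.1 a, x.1.2.unop a)
  map_add' _ _ := rfl
  map_smul' _ _ := rfl

variable (A) in
theorem isLocallyConvexTopology_strictTopology : IsLocallyConvexTopology (strictTopology A) := by
  have := (isLocallyConvexTopology_proTopology A).locallyConvex
  have h : IsLocallyConvexTopology (Pi.topologicalSpace : TopologicalSpace (A → A × A)) :=
    ⟨inferInstance, inferInstance, inferInstance⟩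
  have h1 := h.induced (multiplierEval (A := A))
  rw [strictTopology]
  exact h1

theorem tendsto_strictTopology {ι : Type*} {l : Filter ι} {u : ι → multiplierAlgebra A}
    {x : multiplierAlgebra A} :
    Tendsto u l (@nhds _ (strictTopology A) x) ↔
      ∀ a, Tendsto (fun i => (u i).1.1 a) l (𝓝 (x.1.1 a)) ∧
        Tendsto (fun i => (u i).1.2.unop a) l (𝓝 (x.1.2.unop a)) := by
  rw [strictTopology, nhds_induced, tendsto_comap_iff, tendsto_pi_nhds]
  refine forall_congr' fun a => ?_
  rw [nhds_prod_eq, tendsto_prod_iff']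
  rfl

theorem continuous_toMultiplier :
    Continuous[proTopology A, strictTopology A] (toMultiplier A) := by
  rw [continuous_iff_le_induced, strictTopology, induced_compose, ← continuous_iff_le_induced]
  refine continuous_pi fun b => ?_
  exact (continuous_id.mul continuous_const).prodMk (continuous_const.mul continuous_id)

theorem toMultiplier_injective : Function.Injective (toMultiplier A) := by
  intro a b h
  refine tendsto_nhds_unique (tendsto_mul_approximateUnit a) ?_
  refine (tendsto_mul_approximateUnit b).congr fun e => ?_
  have h1 := congrArg (fun x : multiplierAlgebra A => x.1.1 (incl A e)) h
  exact h1.symm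

/-- The evaluation of the left component of a multiplier at `a`. -/
def leftEval (a : A) : multiplierAlgebra A →ₗ[ℂ] A where
  toFun x := x.1.1 a
  map_add' _ _ := rfl
  map_smul' _ _ := rfl

theorem continuous_leftEval (a : A) :
    Continuous[strictTopology A, proTopology A] (leftEval a) := by
  have h : Continuous fun y : A → A × A => (y a).1 := by fun_prop
  rw [strictTopology, continuous_iff_le_induced]
  exact (induced_mono (continuous_iff_le_induced.1 h)).trans_eq induced_compose

/-- A strictly bounded set of multipliers maps the unit ball of the bounded elements to a bounded
set. -/
theorem isBoundedFor_multiplier_image {S : Set (multiplierAlgebra A)}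
    (hS : IsBoundedFor (strictTopology A) S) :
    IsBoundedFor (proTopology A)
      ((fun y : multiplierAlgebra A × BoundedElements A => y.1.1.1 (incl A y.2)) ''
        (S ×ˢ Metric.closedBall 0 1)) := by
  have hw := ProCStarAlgebra.withSeminorms (A := A)
  have hpt : ∀ (p : ContinuousCStarSeminorm A) (e : BoundedElements A),
      BddAbove (Set.range fun x : S => p.1 (((x : multiplierAlgebra A).1.1 ∘L incl A) e)) := by
    intro p e
    have h1 : IsBoundedFor (proTopology A) (leftEval (incl A e) '' S) :=
      hS.image (continuous_leftEval _)
    obtain ⟨r, -, hr⟩ := hw.isVonNBounded_iff_seminorm_bounded.1 h1 p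
    refine ⟨r, ?_⟩
    rintro _ ⟨x, rfl⟩
    exact (hr _ ⟨x, x.2, rfl⟩).le
  -- Strict boundedness is only pointwise; Banach–Steinhaus on the Banach space of bounded elements
  -- makes it uniform on the unit ball.
  have hequi := (hw.uniformEquicontinuous_iff_exists_continuous_seminorm
    (fun x : S => (((x : multiplierAlgebra A).1.1 ∘L incl A : BoundedElements A →L[ℂ] A) :
      BoundedElements A →ₗ[ℂ] A))).1 (hw.banach_steinhaus hpt)
  rw [IsBoundedFor, hw.isVonNBounded_iff_seminorm_bounded]
  intro p
  obtain ⟨q, hq, hpq⟩ := hequi p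
  obtain ⟨C, hC, hqC⟩ := q.bound_of_continuous_normedSpace hq
  refine ⟨C + 1, by positivity, ?_⟩
  rintro _ ⟨⟨x, e⟩, ⟨hx, he⟩, rfl⟩
  have h1 := (hpq ⟨x, hx⟩ e).trans (hqC e)
  have h2 : C * ‖e‖ ≤ C := mul_le_of_le_one_right hC.le (mem_closedBall_zero_iff.1 he)
  exact (h1.trans h2).trans_lt (lt_add_one C)

/-- Strictly, `l(e) a = l(e a) → l(a)` and `a l(e) = r(a) e → r(a)`. The net eventually stays in a
strictly bounded set, so the convergence holds for `β_b` too. -/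
theorem tendsto_toMultiplier_approximateUnit (x : multiplierAlgebra A) :
    Tendsto (fun e => toMultiplier A (x.1.1 (incl A e)))
      (CStarAlgebra.approximateUnit (BoundedElements A))
      (@nhds _ (localized (strictTopology A)) x) := by
  have hβ := isLocallyConvexTopology_strictTopology A
  have h1 := isBoundedFor_multiplier_image (isBoundedFor_singleton hβ x)
  have h2 := h1.image (continuous_toMultiplier (A := A))
  refine tendsto_localized hβ (h2.insert hβ x) ?_ (Set.mem_insert _ _) ?_
  · filter_upwards [eventually_norm_le_one] with e he
    exact Set.mem_insert_of_mem _
      ⟨_, ⟨(x, e), ⟨rfl, mem_closedBall_zero_iff.2 he⟩, rfl⟩, rfl⟩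
  · refine tendsto_strictTopology.2 fun a => ⟨?_, ?_⟩
    · refine ((x.1.1.continuous.tendsto a).comp (tendsto_approximateUnit_mul a)).congr fun e => ?_
      exact x.2.1 _ _
    · refine (tendsto_mul_approximateUnit (x.1.2.unop a)).congr fun e => ?_
      exact x.2.2.2 _ _

theorem exists_seminorm_bound (f : A →L[ℂ] ℂ) :
    ∃ p : ContinuousCStarSeminorm A, ∃ C : ℝ, 0 < C ∧ ∀ a, ‖f a‖ ≤ C * p.1 a := by
  obtain ⟨s, C, hC, h⟩ := Seminorm.bound_of_continuous
    (ProCStarAlgebra.withSeminorms (A := A)) ((normSeminorm ℂ ℂ).comp f.toLinearMap)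
    (continuous_norm.comp f.continuous)
  obtain ⟨q, hq⟩ := ContinuousCStarSeminorm.exists_finset_sup_le s
  refine ⟨q, C, by positivity, fun a => (h a).trans ?_⟩
  exact mul_le_mul_of_nonneg_left (hq a) C.2

/-- On the image of `A`, the seminorm `(l, r) ↦ 2C p(l(c))` is `a ↦ 2C p(a c)`, which dominates `f`.
Hahn–Banach then applies. -/
theorem exists_strict_extension (f : A →L[ℂ] ℂ) :
    ∃ g : multiplierAlgebra A →ₗ[ℂ] ℂ, Continuous[strictTopology A, inferInstance] g ∧
      ∀ a, g (toMultiplier A a) = f a := by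
  obtain ⟨p, C, hC, hf⟩ := exists_seminorm_bound f
  obtain ⟨c, hc⟩ := exists_functional_le_seminorm_mul p f.toLinearMap hC hf
  let T := LinearEquiv.ofInjective (toMultiplier A) toMultiplier_injective
  let P : Seminorm ℂ (multiplierAlgebra A) := (p.1.comp (leftEval c))
  let K : NNReal := ⟨2 * C, by positivity⟩
  obtain ⟨g, hg, hgP⟩ := Module.Dual.exists_extension_of_le_seminorm
    (LinearMap.range (toMultiplier A)) (f.toLinearMap ∘ₗ T.symm.toLinearMap) (p := K • P) (by
      intro x
      obtain ⟨a, rfl⟩ := T.surjective x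
      have h1 : (f.toLinearMap ∘ₗ T.symm.toLinearMap) (T a) = f a := by simp
      rw [h1]
      exact hc a)
  refine ⟨g, ?_, fun a => ?_⟩
  · refine (isLocallyConvexTopology_strictTopology A).continuous_of_tendsto_zero ?_
    have h1 : Tendsto (leftEval c) (@nhds _ (strictTopology A) 0) (𝓝 0) :=
      @Continuous.tendsto' _ _ (strictTopology A) _ _ (continuous_leftEval c) 0 0 (map_zero _)
    have h2 : Tendsto (fun a => 2 * C * p.1 a) (𝓝 0) (𝓝 0) :=
      (p.2.2.const_mul (2 * C)).tendsto' 0 0 (by simp)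
    exact squeeze_zero_norm (fun x => hgP x) (h2.comp h1)
  · have h1 := hg (T a)
    simpa [T] using h1

end Multipliers

/-! ### The restriction maps between the strong duals. -/

section Duals

open Bornology BoundedElements

variable {E F : Type*} [AddCommGroup E] [Module ℂ E] [AddCommGroup F] [Module ℂ F]

/-- A continuous linear map, between the retopologized spaces. -/
def Retop.map {σ : TopologicalSpace E} {θ : TopologicalSpace F} (L : E →ₗ[ℂ] F)
    (hL : Continuous[σ, θ] L) : Retop E σ →L[ℂ] Retop F θ where
  toLinearMap := (Retop.of θ).toLinearMap ∘ₗ L ∘ₗ (Retop.of σ).symm.toLinearMap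
  cont := hL

/-- Restriction of functionals along a continuous linear map. -/
noncomputable def Retop.dualMap {σ : TopologicalSpace E} {θ : TopologicalSpace F} (L : E →ₗ[ℂ] F)
    (hL : Continuous[σ, θ] L) : StrongDual ℂ (Retop F θ) →L[ℂ] StrongDual ℂ (Retop E σ) :=
  ContinuousLinearMap.precomp ℂ (Retop.map L hL)

theorem Retop.isEmbedding_dualMap {σ : TopologicalSpace E} {θ : TopologicalSpace F}
    (hθ : IsLocallyConvexTopology θ) (L : E →ₗ[ℂ] F) (hL : Continuous[σ, θ] L)
    (h : ∀ S : Set F, IsBoundedFor θ S → ∃ R : Set E, IsBoundedFor σ R ∧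
      ∀ f : F →ₗ[ℂ] ℂ, Continuous[θ, inferInstance] f →
        ∀ x ∈ S, f x ∈ closure ((fun a => f (L a)) '' R)) :
    IsEmbedding (Retop.dualMap L hL) := by
  have : ContinuousSMul ℂ (Retop F θ) := hθ.smul
  refine isEmbedding_precomp_of_forall_bounded (Retop.map L hL) fun S hS => ?_
  obtain ⟨R, hR, hRS⟩ := h S hS
  exact ⟨R, hR, fun f => hRS (f.toLinearMap ∘ₗ (Retop.of θ).toLinearMap) f.continuous⟩

theorem Retop.isEmbedding_dualMap_id {σ : TopologicalSpace E} (hσ : IsLocallyConvexTopology σ) :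
    IsEmbedding (Retop.dualMap (σ := localized σ) (θ := σ) LinearMap.id
      (continuous_id_iff_le.2 (localized_le hσ))) :=
  Retop.isEmbedding_dualMap hσ _ _ fun S hS =>
    ⟨S, isBoundedFor_localized hσ hS, fun _ _ x hx => subset_closure ⟨x, hx, rfl⟩⟩

variable {A : Type*} [NonUnitalRing A] [StarRing A] [Module ℂ A] [IsScalarTower ℂ A A]
  [SMulCommClass ℂ A A] [StarModule ℂ A] [UniformSpace A] [ProCStarAlgebra A]

/-- Allowing all `β_b`-continuous functionals lets the same `R` serve the duals of both `β` and
`β_b`. -/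
theorem exists_isBoundedFor_forall_mem_closure {S : Set (multiplierAlgebra A)}
    (hS : IsBoundedFor (strictTopology A) S) :
    ∃ R : Set A, IsBoundedFor (proTopology A) R ∧ ∀ f : multiplierAlgebra A →ₗ[ℂ] ℂ,
      Continuous[localized (strictTopology A), inferInstance] f →
        ∀ x ∈ S, f x ∈ closure ((fun a => f (toMultiplier A a)) '' R) := by
  refine ⟨_, isBoundedFor_multiplier_image hS, fun f hf x hx => ?_⟩
  have h := (@Continuous.tendsto _ _ (localized (strictTopology A)) _ _ hf x).comp
    (tendsto_toMultiplier_approximateUnit x)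
  refine mem_closure_of_tendsto h ?_
  filter_upwards [eventually_norm_le_one] with e he
  exact ⟨_, ⟨(x, e), ⟨hx, mem_closedBall_zero_iff.2 he⟩, rfl⟩, rfl⟩

theorem isEmbedding_dualMap_toMultiplier :
    IsEmbedding (Retop.dualMap (toMultiplier A) continuous_toMultiplier) := by
  have hβ := isLocallyConvexTopology_strictTopology A
  refine Retop.isEmbedding_dualMap hβ _ _ fun S hS => ?_
  obtain ⟨R, hR, h⟩ := exists_isBoundedFor_forall_mem_closure hS
  exact ⟨R, hR, fun f hf => h f (continuous_le_dom (localized_le hβ) hf)⟩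

theorem continuous_localized_toMultiplier :
    Continuous[localized (proTopology A), localized (strictTopology A)] (toMultiplier A) :=
  continuous_localized (isLocallyConvexTopology_proTopology A)
    (isLocallyConvexTopology_strictTopology A) _ continuous_toMultiplier

theorem isEmbedding_dualMap_localized_toMultiplier :
    IsEmbedding (Retop.dualMap (toMultiplier A) continuous_localized_toMultiplier) := by
  have hβ := isLocallyConvexTopology_strictTopology A
  refine Retop.isEmbedding_dualMap hβ.localized _ _ fun S hS => ?_
  obtain ⟨R, hR, h⟩ := exists_isBoundedFor_forall_mem_closure
    (IsVonNBounded.of_topologicalSpace_le (localized_le hβ) hS)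
  exact ⟨R, isBoundedFor_localized (isLocallyConvexTopology_proTopology A) hR, h⟩

theorem surjective_dualMap_toMultiplier :
    Function.Surjective (Retop.dualMap (toMultiplier A) continuous_toMultiplier) := by
  intro f
  obtain ⟨g, hg, hgf⟩ := exists_strict_extension (A := A)
    ⟨f.toLinearMap ∘ₗ (Retop.of (proTopology A)).toLinearMap, f.continuous⟩
  refine ⟨⟨g ∘ₗ (Retop.of (strictTopology A)).symm.toLinearMap, hg⟩, ?_⟩
  ext a
  exact hgf a

end Duals

theorem mainTheorem3 (A : Type*) [NonUnitalRing A] [StarRing A] [Module ℂ A]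
    [IsScalarTower ℂ A A] [SMulCommClass ℂ A A] [StarModule ℂ A] [UniformSpace A]
    [ProCStarAlgebra A] :
    ∃ (j : StrongDual ℂ (Retop (multiplierAlgebra A) (strictTopology A)) →L[ℂ]
          StrongDual ℂ (Retop (multiplierAlgebra A) (localized (strictTopology A))))
      (ρb : StrongDual ℂ (Retop (multiplierAlgebra A) (localized (strictTopology A))) →L[ℂ]
          StrongDual ℂ (Retop A (localized (proTopology A))))
      (ρ : StrongDual ℂ (Retop (multiplierAlgebra A) (strictTopology A)) ≃L[ℂ]
          StrongDual ℂ (Retop A (proTopology A)))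
      (i : StrongDual ℂ (Retop A (proTopology A)) →L[ℂ]
          StrongDual ℂ (Retop A (localized (proTopology A)))),
      (∀ f x, j f (Retop.of (localized (strictTopology A)) x) =
        f (Retop.of (strictTopology A) x)) ∧
      (∀ f a, ρb f (Retop.of (localized (proTopology A)) a) =
        f (Retop.of (localized (strictTopology A)) (toMultiplier A a))) ∧
      (∀ f a, ρ f (Retop.of (proTopology A) a) =
        f (Retop.of (strictTopology A) (toMultiplier A a))) ∧
      (∀ f a, i f (Retop.of (localized (proTopology A)) a) =
        f (Retop.of (proTopology A) a)) ∧
      IsEmbedding j ∧ IsEmbedding ρb ∧ IsEmbedding i ∧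
      ((∀ f : A →ₗ[ℂ] ℂ, Continuous[proTopology A, inferInstance] f ↔
          Continuous[localized (proTopology A), inferInstance] f) →
        IsHomeomorph i ∧ IsHomeomorph j ∧ IsHomeomorph ρb) := by
  have hτ := isLocallyConvexTopology_proTopology A
  have hβ := isLocallyConvexTopology_strictTopology A
  have hj := Retop.isEmbedding_dualMap_id hβ
  have hi := Retop.isEmbedding_dualMap_id hτ
  have hρb := isEmbedding_dualMap_localized_toMultiplier (A := A)
  have hρ := isEmbedding_dualMap_toMultiplier (A := A)
  have hρs := surjective_dualMap_toMultiplier (A := A)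
  let ρ₀ := Retop.dualMap (toMultiplier A) (continuous_toMultiplier (A := A))
  let e := LinearEquiv.ofBijective ρ₀.toLinearMap ⟨hρ.injective, hρs⟩
  have hesymm : ∀ g, ρ₀ (e.symm g) = g := e.apply_symm_apply
  refine ⟨_, _, ⟨e, ρ₀.continuous, ?_⟩, _, fun f x => rfl, fun f a => rfl, fun f a => rfl,
    fun f a => rfl, hj, hρb, hi, fun hdual => ?_⟩
  · refine hρ.continuous_iff.2 (continuous_id.congr fun g => ?_)
    exact (hesymm g).symm
  · have his : Function.Surjective (Retop.dualMap (σ := localized (proTopology A))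
        (θ := proTopology A) LinearMap.id (continuous_id_iff_le.2 (localized_le hτ))) := by
      intro f
      have hf := (hdual (f.toLinearMap ∘ₗ
        (Retop.of (localized (proTopology A))).toLinearMap)).2 f.continuous
      exact ⟨⟨f.toLinearMap ∘ₗ (Retop.of (localized (proTopology A))).toLinearMap ∘ₗ
        (Retop.of (proTopology A)).symm.toLinearMap, hf⟩, rfl⟩
    -- By commutativity, `ρb ∘ j = i ∘ ρ` is surjective. Hence `ρb` is surjective, and since it is
    -- also injective, so is `j`.
    have hfactor : ∀ f, ∃ g, Retop.dualMap (toMultiplier A) continuous_localized_toMultiplier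
        (Retop.dualMap (σ := localized (strictTopology A)) (θ := strictTopology A) LinearMap.id
          (continuous_id_iff_le.2 (localized_le hβ)) g) = f := by
      intro f
      obtain ⟨f₁, rfl⟩ := his f
      obtain ⟨g, rfl⟩ := hρs f₁
      exact ⟨g, rfl⟩
    simp only [isHomeomorph_iff_isEmbedding_surjective]
    refine ⟨⟨hi, his⟩, ⟨hj, fun f => ?_⟩, ⟨hρb, fun f => ?_⟩⟩
    · obtain ⟨g, hg⟩ := hfactor (Retop.dualMap (toMultiplier A)
        continuous_localized_toMultiplier f)
      exact ⟨g, hρb.injective hg⟩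
    · obtain ⟨g, hg⟩ := hfactor f
      exact ⟨_, hg⟩
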